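/- Let $G$ be a non-compact locally compact (Hausdorff) group. A unitary representation $\pi$ of $G$ is a homomorphism from $G$ into the unitary group of a complex Hilbert space $\mathcal H_\pi$ such that $s\mapsto\pi(s)\xi$ is continuous for every $\xi\in\mathcal H_\pi$; its matrix coefficients are the functions $\pi_{\xi,\eta}(s)=\langle\pi(s)\xi,\eta\rangle$ on $G$, for $\xi,\eta\in\mathcal H_\pi$. Let $B(G)$ be the Fourier–Stieltjes algebra, that is, the set of all matrix coefficients of all unitary representations of $G$ (a complex vector space under pointwise operations), let $C_0(G)$ be the space of continuous complex functions on $G$ vanishing at infinity, let $B_0(G)=B(G)\cap C_0(G)$, and let $1_G$ be the constant function $1$ on $G$. A unitary representation is purely infinite if it has no nonzero finite dimensional subrepresentation, and $A_{\mathcal{PI}}(G)$ is the set of all matrix coefficients of purely infinite unitary representations of $G$. The group $G$ has the Howe–Moore property if every unitary representation $\pi$ of $G$ either has a nonzero invariant vector or satisfies $\pi_{\xi,\eta}\in C_0(G)$ for all $\xi,\eta\in\mathcal H_\pi$. The group $G$ is minimally almost periodic if its almost periodic (Bohr) compactification $G^{\mathrm{AP}}$, i.e. the universal compact Hausdorff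 group receiving a continuous homomorphism with dense range from $G$, is trivial. Then the following are equivalent: 1. $G$ has the Howe–Moore property; 2. $B(G)=B_0(G)\oplus\mathbb C1_G$; 3. $G$ is minimally almost periodic and $A_{\mathcal{PI}}(G)=B_0(G)$. -/

import Mathlib

open Filter Topology
open scoped ZeroAtInfty

universe u

noncomputable section

namespace HoweMoore

/-- A (strongly continuous) unitary representation of `G` on a complex inner product space `H`;
it is only ever used with `H` complete. A unitary operator is a surjective linear isometry. -/
structure UnitaryRep (G : Type u) [Group G] [TopologicalSpace G]
    (H : Type u) [NormedAddCommGroup H] [InnerProductSpace ℂ H] where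
  /-- the underlying homomorphism into the unitary group of `H` -/
  toHom : G →* (H ≃ₗᵢ[ℂ] H)
  continuous_apply : ∀ ξ : H, Continuous fun g : G => toHom g ξ

namespace UnitaryRep

variable {G : Type u} [Group G] [TopologicalSpace G]
variable {H : Type u} [NormedAddCommGroup H] [InnerProductSpace ℂ H]
variable {K : Type u} [NormedAddCommGroup K] [InnerProductSpace ℂ K]

/-- The matrix coefficient `s ↦ ⟨π(s)ξ, η⟩`, the inner product being linear in the first variable
(Mathlib's `inner` is linear in the second one). -/
def coeff (π : UnitaryRep G H) (ξ η : H) : G → ℂ :=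
  fun s => inner ℂ η (π.toHom s ξ)

/-- `π` has a nonzero invariant vector. -/
def HasInvariantVector (π : UnitaryRep G H) : Prop :=
  ∃ ξ : H, ξ ≠ 0 ∧ ∀ g : G, π.toHom g ξ = ξ

/-- `π` is purely infinite: it has no nonzero finite dimensional subrepresentation. -/
def IsPurelyInfinite (π : UnitaryRep G H) : Prop :=
  ∀ W : Submodule ℂ H, (∀ g : G, ∀ w ∈ W, π.toHom g w ∈ W) → FiniteDimensional ℂ W → W = ⊥

/-- The trivial representation on `H`. -/
def trivial (G : Type u) [Group G] [TopologicalSpace G]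
    (H : Type u) [NormedAddCommGroup H] [InnerProductSpace ℂ H] : UnitaryRep G H where
  toHom := 1
  continuous_apply ξ := by simpa using continuous_const

/-- The Hilbert space direct sum of two representations. -/
def directSum (π : UnitaryRep G H) (σ : UnitaryRep G K) : UnitaryRep G (WithLp 2 (H × K)) where
  toHom :=
    { toFun := fun g => LinearIsometryEquiv.withLpProdCongr 2 (π.toHom g) (σ.toHom g)
      map_one' := by ext x <;> simp <;> rfl
      map_mul' := fun a b => by ext x <;> simp }
  continuous_apply ξ := by
    have h : Continuous fun g : G => (π.toHom g ξ.fst, σ.toHom g ξ.snd) :=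
      (π.continuous_apply ξ.fst).prodMk (σ.continuous_apply ξ.snd)
    exact (WithLp.prod_continuous_toLp 2 H K).comp h

end UnitaryRep

variable (G : Type u) [Group G] [TopologicalSpace G]

/-- The continuous functions `G → ℂ` vanishing at infinity, as a space of functions. -/
def zeroAtInfty : Submodule ℂ (G → ℂ) where
  carrier := {f | ∃ F : C₀(G, ℂ), (F : G → ℂ) = f}
  zero_mem' := ⟨0, rfl⟩
  add_mem' := by
    rintro _ _ ⟨F, rfl⟩ ⟨F', rfl⟩
    exact ⟨F + F', rfl⟩
  smul_mem' := by
    rintro c _ ⟨F, rfl⟩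
    exact ⟨c • F, rfl⟩

/-- The Fourier–Stieltjes algebra `B(G)` as a space of functions: all matrix coefficients of
unitary representations of `G` on Hilbert spaces. A matrix coefficient `⟨π(·)ξ, η⟩` only depends on
the cyclic subrepresentation generated by `ξ`, which is unitarily equivalent to one on a Hilbert
space in the universe of `G`. -/
def fourierStieltjes : Submodule ℂ (G → ℂ) where
  carrier := {u | ∃ (H : Type u) (_ : NormedAddCommGroup H) (_ : InnerProductSpace ℂ H)
    (_ : CompleteSpace H) (π : UnitaryRep G H) (ξ η : H), π.coeff ξ η = u}
  zero_mem' := by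
    refine ⟨EuclideanSpace ℂ PEmpty.{u + 1}, inferInstance, inferInstance, inferInstance,
      UnitaryRep.trivial G _, 0, 0, ?_⟩
    funext s
    simp [UnitaryRep.coeff]
  add_mem' := by
    rintro _ _ ⟨H, _, _, _, π, ξ, η, rfl⟩ ⟨K, _, _, _, σ, ξ', η', rfl⟩
    refine ⟨WithLp 2 (H × K), inferInstance, inferInstance, inferInstance,
      π.directSum σ, WithLp.toLp 2 (ξ, ξ'), WithLp.toLp 2 (η, η'), ?_⟩
    funext s
    simp [UnitaryRep.coeff, UnitaryRep.directSum]
  smul_mem' := by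
    rintro c _ ⟨H, _, _, _, π, ξ, η, rfl⟩
    refine ⟨H, inferInstance, inferInstance, inferInstance, π, c • ξ, η, ?_⟩
    funext s
    simp [UnitaryRep.coeff]

/-- The Rajchman algebra `B₀(G) = B(G) ∩ C₀(G)`. -/
def rajchman : Submodule ℂ (G → ℂ) :=
  fourierStieltjes G ⊓ zeroAtInfty G

/-- The set `A_PI(G)` of all matrix coefficients of purely infinite representations. -/
def purelyInfiniteCoeffs : Set (G → ℂ) :=
  {u | ∃ (H : Type u) (_ : NormedAddCommGroup H) (_ : InnerProductSpace ℂ H)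
    (_ : CompleteSpace H) (π : UnitaryRep G H) (ξ η : H),
    π.IsPurelyInfinite ∧ π.coeff ξ η = u}

/-- The Howe–Moore property: every unitary representation of `G` has a nonzero invariant vector, or
all its matrix coefficients vanish at infinity. -/
def HasHoweMooreProperty : Prop :=
  ∀ (H : Type u) [NormedAddCommGroup H] [InnerProductSpace ℂ H] [CompleteSpace H]
    (π : UnitaryRep G H),
    π.HasInvariantVector ∨ ∀ ξ η : H, π.coeff ξ η ∈ zeroAtInfty G

/-- A compact Hausdorff group together with a continuous homomorphism from `G` into it. A compact
Hausdorff group with a dense image of `G` has cardinality at most `2 ^ 2 ^ |G|`, so the universe of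
`G` is large enough. -/
structure CompactTarget : Type (u + 1) where
  carrier : Type u
  [group : Group carrier]
  [topologicalSpace : TopologicalSpace carrier]
  [isTopologicalGroup : IsTopologicalGroup carrier]
  [compactSpace : CompactSpace carrier]
  [t2Space : T2Space carrier]
  hom : G →ₜ* carrier

attribute [instance] CompactTarget.group CompactTarget.topologicalSpace
  CompactTarget.isTopologicalGroup CompactTarget.compactSpace CompactTarget.t2Space

/-- The diagonal homomorphism of `G` into the product of all its compact targets. -/
def toCompactTargets : G →ₜ* ((i : CompactTarget G) → i.carrier) where
  toFun g i := i.hom g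
  map_one' := by funext i; simp
  map_mul' a b := by funext i; simp
  continuous_toFun := continuous_pi fun i => i.hom.continuous_toFun

/-- The almost periodic (Bohr) compactification `G^AP`, the universal compact Hausdorff group that
receives a continuous homomorphism from `G` with dense range: the closure of the diagonal image of
`G` in the product of all its compact targets. -/
def APCompactification : Subgroup ((i : CompactTarget G) → i.carrier) :=
  (toCompactTargets G).toMonoidHom.range.topologicalClosure

/-- `G` is minimally almost periodic: its almost periodic compactification is trivial. -/
def IsMinimallyAlmostPeriodic : Prop :=
  Subsingleton (APCompactification G)

end HoweMoore

end

/-!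
In a Hilbert space weak convergence within a norm compact set is norm convergence. Hence, for a
non-compact `G`, a vector whose orbit is relatively compact and all of whose matrix coefficients
vanish at infinity is zero. This applies to vectors of a finite dimensional subrepresentation, and
to all vectors of a representation that factors through a compact group. In the presence of the
Howe–Moore property the former shows that a representation without invariant vectors is purely
infinite, and the latter, applied to the regular representation of a compact group `K`, that every
continuous homomorphism from `G` to `K` is trivial.

In the other direction, if `B(G) = B₀(G) ⊕ ℂ1`, then `π(s)ξ` converges weakly as `s → ∞`. The limit
is invariant, so it vanishes when `π` has no nonzero invariant vector. If `G` is minimally almost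
periodic, then it acts trivially on every finite dimensional subrepresentation, because the unitary
group of a finite dimensional Hilbert space is compact; hence a representation without invariant
vectors is purely infinite.
-/

open MeasureTheory

noncomputable section

namespace HoweMoore

section WeakConvergence

variable {𝕜 E ι : Type*} [RCLike 𝕜] [NormedAddCommGroup E] [InnerProductSpace 𝕜 E]
variable {l : Filter ι} {x : ι → E}

theorem tendsto_of_isCompact_of_tendsto_inner {C : Set E} (hC : IsCompact C)
    (hx : ∀ᶠ i in l, x i ∈ C) {y : E}
    (h : ∀ z, Tendsto (fun i => inner 𝕜 z (x i)) l (𝓝 (inner 𝕜 z y))) :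
    Tendsto x l (𝓝 y) := by
  refine hC.tendsto_nhds_of_unique_mapClusterPt hx fun y' _ hy' => ext_inner_left 𝕜 fun z => ?_
  have hcluster : MapClusterPt (inner 𝕜 z y') l fun i => inner 𝕜 z (x i) :=
    hy'.continuousAt_comp (continuous_const.inner continuous_id).continuousAt
  obtain ⟨U, hU, hlim⟩ := mapClusterPt_iff_ultrafilter.1 hcluster
  exact tendsto_nhds_unique hlim ((h z).mono_left hU)

theorem exists_tendsto_inner_of_norm_le [CompleteSpace E] [l.NeBot] {r : ℝ} (hx : ∀ i, ‖x i‖ ≤ r)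
    (h : ∀ z, ∃ c : 𝕜, Tendsto (fun i => inner 𝕜 z (x i)) l (𝓝 c)) :
    ∃ y, ∀ z, Tendsto (fun i => inner 𝕜 z (x i)) l (𝓝 (inner 𝕜 z y)) := by
  choose c hc using h
  have hlim (z : E) : Tendsto (fun i => inner 𝕜 (x i) z) l (𝓝 (star (c z))) :=
    (hc z).star.congr fun i => inner_conj_symm (x i) z
  let L : E →ₗ[𝕜] 𝕜 := linearMapOfTendsto _ (fun i => innerₛₗ 𝕜 (x i)) (tendsto_pi_nhds.2 hlim)
  have hL (z : E) : ‖L z‖ ≤ r * ‖z‖ :=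
    le_of_tendsto (hlim z).norm <| Eventually.of_forall fun i =>
      (norm_inner_le_norm (x i) z).trans (mul_le_mul_of_nonneg_right (hx i) (norm_nonneg z))
  refine ⟨(InnerProductSpace.toDual 𝕜 E).symm (L.mkContinuous r hL), fun z => ?_⟩
  have hz : inner 𝕜 z ((InnerProductSpace.toDual 𝕜 E).symm (L.mkContinuous r hL)) = c z := by
    rw [← inner_conj_symm, InnerProductSpace.toDual_symm_apply]
    exact star_star (c z)
  exact hz ▸ hc z

end WeakConvergence

namespace UnitaryRep

variable {G : Type u} [Group G] [TopologicalSpace G]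
variable {H : Type u} [NormedAddCommGroup H] [InnerProductSpace ℂ H]

section Basic

variable (π : UnitaryRep G H)

theorem map_mul_apply (g h : G) (ξ : H) : π.toHom (g * h) ξ = π.toHom g (π.toHom h ξ) := by
  rw [map_mul, LinearIsometryEquiv.coe_mul, Function.comp_apply]

theorem map_inv_map_apply (g : G) (ξ : H) : π.toHom g⁻¹ (π.toHom g ξ) = ξ := by
  rw [← map_mul_apply, inv_mul_cancel, map_one, LinearIsometryEquiv.coe_one, id]

theorem inner_map_right (g : G) (ξ η : H) :
    inner ℂ η (π.toHom g ξ) = inner ℂ (π.toHom g⁻¹ η) ξ := by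
  rw [← LinearIsometryEquiv.inner_map_map (π.toHom g⁻¹), map_inv_map_apply]

theorem coeff_add_left (ξ ξ' η : H) : π.coeff (ξ + ξ') η = π.coeff ξ η + π.coeff ξ' η := by
  funext s
  simp only [coeff, map_add, inner_add_right, Pi.add_apply]

theorem continuous_coeff (ξ η : H) : Continuous (π.coeff ξ η) :=
  continuous_const.inner (π.continuous_apply ξ)

theorem coeff_mem_fourierStieltjes [CompleteSpace H] (ξ η : H) :
    π.coeff ξ η ∈ fourierStieltjes G :=
  ⟨H, inferInstance, inferInstance, inferInstance, π, ξ, η, rfl⟩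

/-- The pullback of a unitary representation along a continuous homomorphism. -/
def comap {K : Type u} [Group K] [TopologicalSpace K] (ρ : UnitaryRep K H) (φ : G →ₜ* K) :
    UnitaryRep G H where
  toHom := ρ.toHom.comp φ.toMonoidHom
  continuous_apply ξ := (ρ.continuous_apply ξ).comp φ.continuous_toFun

end Basic

section Restrict

variable (π : UnitaryRep G H) (W : Submodule ℂ H) (hW : ∀ g : G, ∀ w ∈ W, π.toHom g w ∈ W)

/-- The subrepresentation of a unitary representation on an invariant subspace. -/
def restrict : UnitaryRep G W where
  toHom :=
    { toFun := fun g =>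
        { toLinearMap := (π.toHom g).toLinearEquiv.toLinearMap.restrict (hW g)
          invFun := fun w => ⟨π.toHom g⁻¹ w, hW g⁻¹ w w.2⟩
          left_inv := fun w => Subtype.ext (π.map_inv_map_apply g w)
          right_inv := fun w => Subtype.ext (by simp)
          norm_map' := fun w => (π.toHom g).norm_map w }
      map_one' := by
        ext w
        exact congrArg (· (w : H)) (map_one π.toHom)
      map_mul' := fun g h => by
        ext w
        exact π.map_mul_apply g h w }
  continuous_apply w := (π.continuous_apply (w : H)).subtype_mk _

theorem coeff_restrict_orthogonalProjectionOnto [W.HasOrthogonalProjection] (w : W) (η : H) :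
    (π.restrict W hW).coeff w (W.orthogonalProjectionOnto η) = π.coeff w η := by
  funext s
  exact Submodule.inner_orthogonalProjectionOnto_eq_of_mem_right _ _

end Restrict

section Invariants

variable (π : UnitaryRep G H)

/-- The subspace of invariant vectors. -/
def invariants : Submodule ℂ H where
  carrier := {ξ | ∀ g : G, π.toHom g ξ = ξ}
  zero_mem' g := map_zero _
  add_mem' hξ hη g := by rw [map_add, hξ g, hη g]
  smul_mem' c _ hξ g := by rw [map_smul, hξ g]

theorem isClosed_invariants : IsClosed (π.invariants : Set H) := by
  change IsClosed {ξ | ∀ g : G, π.toHom g ξ = ξ}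
  rw [Set.ofPred_forall]
  exact isClosed_iInter fun g => isClosed_eq (π.toHom g).continuous continuous_id

instance [CompleteSpace H] : CompleteSpace π.invariants :=
  π.isClosed_invariants.completeSpace_coe

theorem map_mem_orthogonal_invariants (g : G) (ξ : H) (hξ : ξ ∈ π.invariantsᗮ) :
    π.toHom g ξ ∈ π.invariantsᗮ := by
  rw [Submodule.mem_orthogonal] at hξ ⊢
  intro η hη
  rw [inner_map_right, hη g⁻¹, hξ η hη]

/-- The subrepresentation on the orthogonal complement of the invariant vectors. -/
def nontrivialPart : UnitaryRep G π.invariantsᗮ :=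
  π.restrict _ π.map_mem_orthogonal_invariants

theorem not_hasInvariantVector_nontrivialPart : ¬ π.nontrivialPart.HasInvariantVector := by
  rintro ⟨ξ, hξ, hinv⟩
  have hmem : (ξ : H) ∈ π.invariants := fun g => congrArg Subtype.val (hinv g)
  exact hξ (Subtype.ext (inner_self_eq_zero.1 (Submodule.inner_right_of_mem_orthogonal hmem ξ.2)))

variable {π}

theorem coeff_of_mem_invariants {ξ : H} (hξ : ξ ∈ π.invariants) (η : H) :
    π.coeff ξ η = (inner ℂ η ξ : ℂ) • (1 : G → ℂ) := by
  funext s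
  simp only [coeff, hξ s, Pi.smul_apply, Pi.one_apply, smul_eq_mul, mul_one]

theorem coeff_mem_span_one {ξ : H} (hξ : ξ ∈ π.invariants) (η : H) :
    π.coeff ξ η ∈ Submodule.span ℂ {(1 : G → ℂ)} :=
  Submodule.mem_span_singleton.2 ⟨_, (coeff_of_mem_invariants hξ η).symm⟩

theorem IsPurelyInfinite.not_hasInvariantVector (hπ : π.IsPurelyInfinite) :
    ¬ π.HasInvariantVector := by
  rintro ⟨ξ, hξ, hinv⟩
  refine hξ (Submodule.span_singleton_eq_bot.1 (hπ (ℂ ∙ ξ) (fun g w hw => ?_) inferInstance))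
  obtain ⟨c, rfl⟩ := Submodule.mem_span_singleton.1 hw
  rwa [map_smul, hinv g]

end Invariants

end UnitaryRep

section FunctionSpaces

theorem mem_zeroAtInfty_iff {G : Type u} [TopologicalSpace G] {f : G → ℂ} :
    f ∈ zeroAtInfty G ↔ Continuous f ∧ Tendsto f (cocompact G) (𝓝 0) := by
  constructor
  · rintro ⟨F, rfl⟩
    exact ⟨F.continuous, F.zero_at_infty'⟩
  · rintro ⟨hcont, hlim⟩
    exact ⟨⟨⟨f, hcont⟩, hlim⟩, rfl⟩

variable {G : Type u} [Group G] [TopologicalSpace G]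

theorem one_mem_fourierStieltjes : (1 : G → ℂ) ∈ fourierStieltjes G := by
  let e : EuclideanSpace ℂ PUnit.{u + 1} := EuclideanSpace.single PUnit.unit 1
  convert (UnitaryRep.trivial G (EuclideanSpace ℂ PUnit.{u + 1})).coeff_mem_fourierStieltjes e e
  funext s
  simp [UnitaryRep.coeff, UnitaryRep.trivial, e]

variable (G) in
theorem disjoint_rajchman_span_one [NoncompactSpace G] :
    Disjoint (rajchman G) (Submodule.span ℂ {(1 : G → ℂ)}) := by
  rw [Submodule.disjoint_def]
  rintro f hf hspan
  obtain ⟨c, rfl⟩ := Submodule.mem_span_singleton.1 hspan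
  have hc : Tendsto (fun _ : G => c) (cocompact G) (𝓝 0) :=
    (mem_zeroAtInfty_iff.1 hf.2).2.congr fun s => by simp
  rw [tendsto_nhds_unique tendsto_const_nhds hc, zero_smul]

theorem exists_tendsto_of_mem_rajchman_sup_span_one {f : G → ℂ}
    (hf : f ∈ rajchman G ⊔ Submodule.span ℂ {(1 : G → ℂ)}) :
    ∃ c, Tendsto f (cocompact G) (𝓝 c) := by
  obtain ⟨f₀, hf₀, _, hspan, rfl⟩ := Submodule.mem_sup.1 hf
  obtain ⟨c, rfl⟩ := Submodule.mem_span_singleton.1 hspan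
  refine ⟨c, ?_⟩
  simpa [Pi.add_def] using (mem_zeroAtInfty_iff.1 hf₀.2).2.add_const c

end FunctionSpaces

namespace UnitaryRep

variable {G : Type u} [Group G] [TopologicalSpace G]
variable {H : Type u} [NormedAddCommGroup H] [InnerProductSpace ℂ H]
variable (π : UnitaryRep G H)

theorem eq_zero_of_orbit_subset_isCompact [NoncompactSpace G] {C : Set H} (hC : IsCompact C) {ξ : H}
    (horbit : ∀ g, π.toHom g ξ ∈ C) (h : ∀ η, π.coeff ξ η ∈ zeroAtInfty G) : ξ = 0 := by
  have hlim : Tendsto (fun g => π.toHom g ξ) (cocompact G) (𝓝 0) :=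
    tendsto_of_isCompact_of_tendsto_inner (𝕜 := ℂ) hC (Eventually.of_forall horbit) fun η => by
      rw [inner_zero_right]
      exact (mem_zeroAtInfty_iff.1 (h η)).2
  have hnorm : Tendsto (fun _ : G => ‖ξ‖) (cocompact G) (𝓝 0) := by
    simpa only [LinearIsometryEquiv.norm_map, norm_zero] using hlim.norm
  exact norm_eq_zero.1 (tendsto_nhds_unique tendsto_const_nhds hnorm)

theorem isPurelyInfinite_of_coeff_mem_zeroAtInfty [NoncompactSpace G]
    (h : ∀ ξ η : H, π.coeff ξ η ∈ zeroAtInfty G) : π.IsPurelyInfinite := by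
  intro W hW _
  refine W.eq_bot_iff.2 fun w hw => ?_
  have := FiniteDimensional.proper ℂ W
  have hball : IsCompact ((↑) '' Metric.closedBall (0 : W) ‖w‖ : Set H) :=
    (isCompact_closedBall 0 ‖w‖).image continuous_subtype_val
  refine π.eq_zero_of_orbit_subset_isCompact hball (fun g => ?_) (h w)
  exact ⟨⟨π.toHom g w, hW g w hw⟩, by simp, rfl⟩

theorem mem_invariants_of_tendsto_coeff [SeparatelyContinuousMul G] [NoncompactSpace G] {ξ ζ : H}
    (h : ∀ η, Tendsto (π.coeff ξ η) (cocompact G) (𝓝 (inner ℂ η ζ))) : ζ ∈ π.invariants := by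
  intro g
  refine ext_inner_left ℂ fun η => ?_
  have htranslate : Tendsto (fun s => g * s) (cocompact G) (cocompact G) :=
    (Homeomorph.mulLeft g).isClosedEmbedding.tendsto_cocompact
  rw [inner_map_right]
  refine tendsto_nhds_unique (h (π.toHom g⁻¹ η)) (((h η).comp htranslate).congr fun s => ?_)
  rw [Function.comp_apply, coeff, coeff, map_mul_apply, inner_map_right]

theorem coeff_mem_zeroAtInfty_of_tendsto [SeparatelyContinuousMul G] [NoncompactSpace G]
    [CompleteSpace H] (hinv : ¬ π.HasInvariantVector) {ξ : H}
    (h : ∀ η, ∃ c, Tendsto (π.coeff ξ η) (cocompact G) (𝓝 c)) (η : H) :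
    π.coeff ξ η ∈ zeroAtInfty G := by
  obtain ⟨ζ, hζ⟩ := exists_tendsto_inner_of_norm_le (𝕜 := ℂ) (x := fun g => π.toHom g ξ)
    (fun g => ((π.toHom g).norm_map ξ).le) h
  have hζ_zero : ζ = 0 := by
    by_contra hne
    exact hinv ⟨ζ, hne, π.mem_invariants_of_tendsto_coeff hζ⟩
  refine mem_zeroAtInfty_iff.2 ⟨π.continuous_coeff ξ η, ?_⟩
  rw [← inner_zero_right η, ← hζ_zero]
  exact hζ η

end UnitaryRep

section Koopman

variable {G : Type u} [Group G] [TopologicalSpace G] [ContinuousInv G]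
variable {X : Type u} [TopologicalSpace X] [MeasurableSpace X] [BorelSpace X]
variable [MulAction G X] [ContinuousSMul G X]
variable (μ : Measure X) [IsLocallyFiniteMeasure μ] [μ.InnerRegularCompactLTTop]
variable [SMulInvariantMeasure G X μ]

/-- The Koopman representation of a group acting on a space `X` with an invariant measure `μ`: the
unitary representation on `L²(X, μ)` in which `g` maps `f` to `f (g⁻¹ • ·)`. For a locally compact
group acting on itself by left translations it is the left regular representation. -/
def koopman [R1Space X] : UnitaryRep G (Lp ℂ 2 μ) where
  toHom :=
    { toFun := fun g =>
        { DistribMulAction.toLinearEquiv ℂ (Lp ℂ 2 μ) (DomMulAct.mk g⁻¹) with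
          norm_map' := DomMulAct.norm_smul_Lp _ }
      map_one' := by
        ext1 f
        change DomMulAct.mk (1 : G)⁻¹ • f = f
        rw [inv_one, DomMulAct.mk_one, one_smul]
      map_mul' := fun g h => by
        ext1 f
        change DomMulAct.mk (g * h)⁻¹ • f = DomMulAct.mk g⁻¹ • DomMulAct.mk h⁻¹ • f
        rw [mul_inv_rev, DomMulAct.mk_mul, mul_smul] }
  continuous_apply f := by
    borelize G
    have : Fact ((2 : ENNReal) ≠ ⊤) := ⟨ENNReal.ofNat_ne_top⟩
    have hmk : Continuous fun g : G => DomMulAct.mk g⁻¹ :=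
      DomMulAct.continuous_mk.comp continuous_inv
    exact hmk.smul continuous_const

theorem smul_eq_self_of_koopman_apply_eq [T2Space X] [LocallyCompactSpace X] [μ.IsOpenPosMeasure]
    {g : G} (h : ∀ f, (koopman μ).toHom g f = f) (x : X) : g • x = x := by
  by_contra hne
  obtain ⟨f, hf_one, hf_zero, hf_supp, -⟩ := exists_continuous_one_zero_of_isCompact
    (isCompact_singleton (x := x)) (isClosed_singleton (x := g • x))
    (Set.disjoint_singleton.2 (Ne.symm hne))
  let F : X → ℂ := fun y => (f y : ℂ)
  have hF : Continuous F := Complex.continuous_ofReal.comp f.continuous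
  have hLp : MemLp F 2 μ :=
    hF.memLp_of_hasCompactSupport (hf_supp.comp_left Complex.ofReal_zero)
  have htoLp : DomMulAct.mk g⁻¹ • hLp.toLp F = hLp.toLp F := h (hLp.toLp F)
  rw [DomMulAct.mk_smul_toLp, MemLp.toLp_eq_toLp_iff] at htoLp
  have heq : (F ∘ (g⁻¹ • ·)) = F :=
    (Continuous.ae_eq_iff_eq μ (hF.comp (continuous_const_smul g⁻¹)) hF).1 htoLp
  have hval : f x = f (g • x) := by simpa [F] using congrFun heq (g • x)
  exact one_ne_zero ((hf_one rfl).symm.trans (hval.trans (hf_zero rfl)))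

end Koopman

section MinimallyAlmostPeriodic

variable {G : Type u} [Group G] [TopologicalSpace G]

theorem isMinimallyAlmostPeriodic_iff :
    IsMinimallyAlmostPeriodic G ↔ ∀ (i : CompactTarget G) (g : G), i.hom g = 1 := by
  constructor
  · intro h i g
    have hg : toCompactTargets G g ∈ APCompactification G :=
      Subgroup.le_topologicalClosure _ ⟨g, rfl⟩
    have heq := congrArg Subtype.val (h.elim ⟨_, hg⟩ (1 : APCompactification G))
    exact congrFun heq i
  · intro h
    have hrange : (toCompactTargets G).toMonoidHom.range = ⊥ := by
      rw [eq_bot_iff]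
      rintro _ ⟨g, rfl⟩
      exact Subgroup.mem_bot.2 (funext fun i => h i g)
    have hbot : APCompactification G = ⊥ := by
      rw [APCompactification, hrange]
      exact SetLike.coe_injective (by simp [Subgroup.topologicalClosure_coe])
    rw [IsMinimallyAlmostPeriodic, hbot]
    infer_instance

theorem isCompact_unitary (A : Type*) [CStarAlgebra A] [FiniteDimensional ℂ A] :
    IsCompact (unitary A : Set A) := by
  have : ProperSpace A := FiniteDimensional.proper ℂ A
  refine (isCompact_closedBall (0 : A) 1).of_isClosed_subset isClosed_unitary fun u hu => ?_
  rw [mem_closedBall_zero_iff]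
  rcases subsingleton_or_nontrivial A with _ | _
  · simp [Subsingleton.elim u 0]
  · exact (CStarRing.norm_of_mem_unitary hu).le

/-- The unitary group of a finite dimensional representation, as a compact target. -/
def unitaryTarget {W : Type u} [NormedAddCommGroup W] [InnerProductSpace ℂ W]
    [FiniteDimensional ℂ W] (π : UnitaryRep G W) : CompactTarget G :=
  haveI : CompleteSpace W := FiniteDimensional.complete ℂ W
  haveI : CompactSpace (unitary (W →L[ℂ] W)) :=
    isCompact_iff_compactSpace.1 (isCompact_unitary (W →L[ℂ] W))
  { carrier := unitary (W →L[ℂ] W)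
    hom :=
      { toMonoidHom := Unitary.linearIsometryEquiv.symm.toMonoidHom.comp π.toHom
        continuous_toFun :=
          Continuous.subtype_mk (continuous_clm_apply.2 fun w => π.continuous_apply w) _ } }

namespace IsMinimallyAlmostPeriodic

theorem apply_eq_self (hG : IsMinimallyAlmostPeriodic G) {W : Type u} [NormedAddCommGroup W]
    [InnerProductSpace ℂ W] [FiniteDimensional ℂ W] (π : UnitaryRep G W) (g : G) (w : W) :
    π.toHom g w = w := by
  have : CompleteSpace W := FiniteDimensional.complete ℂ W
  have hone : (unitaryTarget π).hom g = 1 := isMinimallyAlmostPeriodic_iff.1 hG _ g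
  exact congrArg (fun u : unitary (W →L[ℂ] W) => (u : W →L[ℂ] W) w) hone

theorem isPurelyInfinite (hG : IsMinimallyAlmostPeriodic G) {H : Type u} [NormedAddCommGroup H]
    [InnerProductSpace ℂ H] {π : UnitaryRep G H} (hinv : ¬ π.HasInvariantVector) :
    π.IsPurelyInfinite := by
  intro W hW _
  refine W.eq_bot_iff.2 fun w hw => ?_
  by_contra hne
  exact hinv ⟨w, hne, fun g => congrArg Subtype.val (hG.apply_eq_self (π.restrict W hW) g ⟨w, hw⟩)⟩

theorem hasHoweMooreProperty (hG : IsMinimallyAlmostPeriodic G)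
    (hcoeffs : purelyInfiniteCoeffs G ⊆ zeroAtInfty G) : HasHoweMooreProperty G := by
  intro H _ _ _ π
  refine or_iff_not_imp_left.2 fun hinv ξ η => hcoeffs ?_
  exact ⟨H, inferInstance, inferInstance, inferInstance, π, ξ, η, hG.isPurelyInfinite hinv, rfl⟩

end IsMinimallyAlmostPeriodic

end MinimallyAlmostPeriodic

namespace HasHoweMooreProperty

variable {G : Type u} [Group G] [TopologicalSpace G]
variable {H : Type u} [NormedAddCommGroup H] [InnerProductSpace ℂ H] [CompleteSpace H]

theorem of_fourierStieltjes_le [SeparatelyContinuousMul G] [NoncompactSpace G]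
    (h : fourierStieltjes G ≤ rajchman G ⊔ Submodule.span ℂ {(1 : G → ℂ)}) :
    HasHoweMooreProperty G := by
  intro H _ _ _ π
  refine or_iff_not_imp_left.2 fun hinv ξ => π.coeff_mem_zeroAtInfty_of_tendsto hinv fun η => ?_
  exact exists_tendsto_of_mem_rajchman_sup_span_one (h (π.coeff_mem_fourierStieltjes ξ η))

theorem coeff_mem_rajchman (hG : HasHoweMooreProperty G) {π : UnitaryRep G H}
    (hinv : ¬ π.HasInvariantVector) (ξ η : H) : π.coeff ξ η ∈ rajchman G :=
  ⟨π.coeff_mem_fourierStieltjes ξ η, (hG H π).resolve_left hinv ξ η⟩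

theorem coeff_mem_rajchman_of_mem_orthogonal_invariants (hG : HasHoweMooreProperty G)
    {π : UnitaryRep G H} {ξ : H} (hξ : ξ ∈ π.invariantsᗮ) (η : H) : π.coeff ξ η ∈ rajchman G := by
  rw [← π.coeff_restrict_orthogonalProjectionOnto _ π.map_mem_orthogonal_invariants ⟨ξ, hξ⟩ η]
  exact hG.coeff_mem_rajchman π.not_hasInvariantVector_nontrivialPart _ _

theorem fourierStieltjes_eq (hG : HasHoweMooreProperty G) :
    fourierStieltjes G = rajchman G ⊔ Submodule.span ℂ {(1 : G → ℂ)} := by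
  apply le_antisymm
  · rintro _ ⟨H, _, _, _, π, ξ, η, rfl⟩
    obtain ⟨ξ₀, hξ₀, ξ₁, hξ₁, rfl⟩ := π.invariants.exists_add_mem_mem_orthogonal ξ
    rw [add_comm, π.coeff_add_left]
    exact Submodule.add_mem_sup (hG.coeff_mem_rajchman_of_mem_orthogonal_invariants hξ₁ η)
      (UnitaryRep.coeff_mem_span_one hξ₀ η)
  · exact sup_le inf_le_left
      ((Submodule.span_singleton_le_iff_mem _ _).2 one_mem_fourierStieltjes)

variable [NoncompactSpace G]

theorem isPurelyInfinite (hG : HasHoweMooreProperty G) {π : UnitaryRep G H}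
    (hinv : ¬ π.HasInvariantVector) : π.IsPurelyInfinite :=
  π.isPurelyInfinite_of_coeff_mem_zeroAtInfty fun ξ η => (hG.coeff_mem_rajchman hinv ξ η).2

theorem purelyInfiniteCoeffs_eq (hG : HasHoweMooreProperty G) :
    purelyInfiniteCoeffs G = (rajchman G : Set (G → ℂ)) := by
  apply Set.Subset.antisymm
  · rintro _ ⟨H, _, _, _, π, ξ, η, hπ, rfl⟩
    exact hG.coeff_mem_rajchman hπ.not_hasInvariantVector ξ η
  · rintro _ ⟨⟨H, _, _, _, π, ξ, η, rfl⟩, hzero⟩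
    have hcoeff : π.coeff ξ η ∈ rajchman G := ⟨π.coeff_mem_fourierStieltjes ξ η, hzero⟩
    obtain ⟨ξ₀, hξ₀, ξ₁, hξ₁, rfl⟩ := π.invariants.exists_add_mem_mem_orthogonal ξ
    rw [π.coeff_add_left] at hcoeff ⊢
    have hξ₁_coeff := hG.coeff_mem_rajchman_of_mem_orthogonal_invariants hξ₁ η
    have hξ₀_coeff : π.coeff ξ₀ η = 0 :=
      Submodule.disjoint_def.1 (disjoint_rajchman_span_one G) _
        ((Submodule.add_mem_iff_left _ hξ₁_coeff).1 hcoeff) (UnitaryRep.coeff_mem_span_one hξ₀ η)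
    rw [hξ₀_coeff, zero_add]
    exact ⟨π.invariantsᗮ, inferInstance, inferInstance, inferInstance, π.nontrivialPart, ⟨ξ₁, hξ₁⟩,
      _, hG.isPurelyInfinite π.not_hasInvariantVector_nontrivialPart,
      π.coeff_restrict_orthogonalProjectionOnto _ _ ⟨ξ₁, hξ₁⟩ η⟩

theorem invariants_comap_eq_top (hG : HasHoweMooreProperty G) {K : Type u} [Group K]
    [TopologicalSpace K] [CompactSpace K] (ρ : UnitaryRep K H) (φ : G →ₜ* K) :
    (ρ.comap φ).invariants = ⊤ := by
  refine Submodule.orthogonal_eq_bot_iff.1 ((Submodule.eq_bot_iff _).2 fun ξ hξ => ?_)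
  exact (ρ.comap φ).eq_zero_of_orbit_subset_isCompact (isCompact_range (ρ.continuous_apply ξ))
    (fun g => ⟨φ g, rfl⟩) fun η => (hG.coeff_mem_rajchman_of_mem_orthogonal_invariants hξ η).2

theorem isMinimallyAlmostPeriodic (hG : HasHoweMooreProperty G) : IsMinimallyAlmostPeriodic G := by
  refine isMinimallyAlmostPeriodic_iff.2 fun i g => ?_
  borelize i.carrier
  have hfixed (f : Lp ℂ 2 (Measure.haar : Measure i.carrier)) :
      (koopman Measure.haar).toHom (i.hom g) f = f := by
    have hf : f ∈ ((koopman Measure.haar).comap i.hom).invariants := by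
      rw [hG.invariants_comap_eq_top]
      trivial
    exact hf g
  simpa using smul_eq_self_of_koopman_apply_eq Measure.haar hfixed 1

end HasHoweMooreProperty

end HoweMoore

end

theorem mainTheorem4_general (G : Type u) [Group G] [TopologicalSpace G] [SeparatelyContinuousMul G]
    [NoncompactSpace G] :
    List.TFAE
      [HoweMoore.HasHoweMooreProperty G,
       HoweMoore.fourierStieltjes G
            = HoweMoore.rajchman G ⊔ Submodule.span ℂ {(1 : G → ℂ)} ∧
          Disjoint (HoweMoore.rajchman G) (Submodule.span ℂ {(1 : G → ℂ)}),
       HoweMoore.IsMinimallyAlmostPeriodic G ∧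
          HoweMoore.purelyInfiniteCoeffs G = (HoweMoore.rajchman G : Set (G → ℂ))] := by
  tfae_have 1 → 2 := fun hG => ⟨hG.fourierStieltjes_eq, HoweMoore.disjoint_rajchman_span_one G⟩
  tfae_have 2 → 1 := fun h => .of_fourierStieltjes_le h.1.le
  tfae_have 1 → 3 := fun hG => ⟨hG.isMinimallyAlmostPeriodic, hG.purelyInfiniteCoeffs_eq⟩
  tfae_have 3 → 1 := fun h => h.1.hasHoweMooreProperty (h.2.le.trans inf_le_right)
  tfae_finish

theorem mainTheorem4 (G : Type u) [Group G] [TopologicalSpace G] [IsTopologicalGroup G]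
    [LocallyCompactSpace G] [T2Space G] [NoncompactSpace G] :
    List.TFAE
      [HoweMoore.HasHoweMooreProperty G,
       HoweMoore.fourierStieltjes G
            = HoweMoore.rajchman G ⊔ Submodule.span ℂ {(1 : G → ℂ)} ∧
          Disjoint (HoweMoore.rajchman G) (Submodule.span ℂ {(1 : G → ℂ)}),
       HoweMoore.IsMinimallyAlmostPeriodic G ∧
          HoweMoore.purelyInfiniteCoeffs G = (HoweMoore.rajchman G : Set (G → ℂ))] := by
  exact mainTheorem4_general G
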